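/- Let $T>0$, let $U\subset\mathbb R^n$ be open, and let $F:\mathbb R\times\mathbb R^n\rightrightarrows\mathbb R^n$ be a set-valued mapping (possibly with empty values outside $[0,T]\times U$) such that for almost every $t\in[0,T]$ one has $F(t,x)\ne\emptyset$ for all $x\in U$, and the graph of $F(t,\cdot)$ over $U$, $\{(x,y): x\in U,\ y\in F(t,x)\}$, is closed in $U\times\mathbb R^n$ (for instance, the whole graph $\operatorname{gr}F(t,\cdot)$ is closed); moreover, for all $(x,y)\in\mathbb R^n\times\mathbb R^n$ the function $t\mapsto d\big((x,y),\operatorname{gr}F(t,\cdot)\big)$ is measurable on $[0,T]$. Assume that there is a summable function $k$ on $[0,T]$ such that for almost every $t\in[0,T]$ $$h\big(F(t,x),F(t,x')\big)\le k(t)\|x-x'\|\qquad\text{for all } x,x'\in U,$$ where $h$ is the Hausdorff distance. Let $x_0(\cdot):[0,T]\to U$ be absolutely continuous, let $a=x_0(0)$, and assume that $\rho(t)=d\big(\dot x_0(t),F(t,x_0(t))\big)$ is summable on $[0,T]$. By a solution on $[0,\tau]$ of the Cauchy problem $$\dot x\in F(t,x),\qquad x(0)=a, \tag{1}$$ we mean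 an absolutely continuous $x(\cdot)$ on $[0,\tau]$ with $x(0)=a$ and $\dot x(t)\in F(t,x(t))$ for almost every $t\in[0,\tau]$. Then there is a solution of (1) with values in $U$ on some $[0,\tau]$ with $0<\tau\le T$. Specifically, for $\tau\in(0,T]$ set $$k_\tau=\int_0^\tau k(t)\,dt,\qquad \xi_\tau=\int_0^\tau\rho(t)\,dt,\qquad r_\tau=\inf_{t\in[0,\tau]}d\big(x_0(t),\mathbb R^n\setminus U\big)$$ (with $r_\tau=\infty$ if $U=\mathbb R^n$). If $k_\tau<1$ and $(1-k_\tau)\,r_\tau>\xi_\tau$, then for every $\varepsilon>0$ there is a solution $x(\cdot)$ of (1) on $[0,\tau]$ with values in $U$ such that $\|\dot x-\dot x_0\|$ is integrable on $[0,\tau]$ and $$\int_0^\tau\|\dot x(t)-\dot x_0(t)\|\,dt\le\frac{1+\varepsilon}{1-k_\tau}\,\xi_\tau .$$ -/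

import Mathlib

open MeasureTheory Set
open scoped ENNReal

namespace DiffIncl

/-- The Euclidean space `ℝⁿ`. -/
abbrev Euc (n : ℕ) : Type := EuclideanSpace ℝ (Fin n)

/-- The graph of a set-valued mapping `G : ℝⁿ ⇉ ℝⁿ` (with `G x = ∅` outside its domain). -/
def graph {n : ℕ} (G : Euc n → Set (Euc n)) : Set (Euc n × Euc n) :=
  {p | p.2 ∈ G p.1}

/-- The graph of `G` over the open set `U` is (relatively) closed in `U × ℝⁿ`. This holds in
particular if the whole graph of `G` is closed in `ℝⁿ × ℝⁿ`. -/
def ClosedGraphOver {n : ℕ} (U : Set (Euc n)) (G : Euc n → Set (Euc n)) : Prop :=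
  ∃ C : Set (Euc n × Euc n), IsClosed C ∧ graph G ∩ U ×ˢ univ = C ∩ U ×ˢ univ

/-- `h(P, Q) ≤ c`, where `h` is the Hausdorff distance, with values in `[0, ∞]`. -/
def HausdorffLE {n : ℕ} (P Q : Set (Euc n)) (c : ℝ) : Prop :=
  Metric.hausdorffEDist P Q ≠ ∞ ∧ Metric.hausdorffDist P Q ≤ c

/-- `x(·)` is a solution on `[0, τ]` of the Cauchy problem `ẋ ∈ F(t, x)`, `x(0) = a`. -/
structure IsSolution {n : ℕ} (F : ℝ → Euc n → Set (Euc n)) (a : Euc n) (τ : ℝ)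
    (x : ℝ → Euc n) : Prop where
  absolutelyContinuous : AbsolutelyContinuousOnInterval x 0 τ
  initial : x 0 = a
  inclusion : ∀ᵐ t ∂(volume.restrict (Icc 0 τ)), deriv x t ∈ F t (x t)

/-- The defect `ρ(t) = d(ẋ₀(t), F(t, x₀(t)))`. -/
noncomputable def defect {n : ℕ} (F : ℝ → Euc n → Set (Euc n)) (x₀ : ℝ → Euc n) (t : ℝ) : ℝ :=
  Metric.infDist (deriv x₀ t) (F t (x₀ t))

/-- The distance `inf {d(x₀(t), ℝⁿ \ U) : t ∈ [0, τ]}` from the trajectory `x₀(·)` on `[0, τ]` to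
the complement of `U`; it is `∞` if `U = ℝⁿ`. -/
noncomputable def trajDist {n : ℕ} (U : Set (Euc n)) (x₀ : ℝ → Euc n) (τ : ℝ) : ℝ≥0∞ :=
  ⨅ t ∈ Icc (0 : ℝ) τ, Metric.infEDist (x₀ t) Uᶜ

end DiffIncl

/-! The proof is Filippov's successive approximation, carried out on velocities in `L¹`. Given a
velocity `v` with curve `x`, choose a measurable `w` almost in `F(t, x(t))` with `‖w - v‖` at most
the defect of `v` plus a small error. With `D = ‖w - v‖` in `L¹`, the two curves differ uniformly by
at most `D`, so the Lipschitz condition bounds the new defect by `k(t) D` plus an error. Up to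
summable errors the step lengths shrink by the factor `K = ∫ k < 1`; their total is at most `(ξ + c)
/ (1 - K)` with `c` as small as desired, which also keeps every curve in `U`. The velocities
converge in `L¹`, and closedness of the graph puts the limit in `F`.

Exact measurable selections are never needed: being near the graph is an open condition, so values
can be picked from a dense sequence (`exists_measurable_approx_selection`). The step is
`IsFilippov.exists_velocity`, its bookkeeping `ApproxSolution.exists_next`, the limit
`IsFilippov.exists_velocity_mem`. -/

/-! ### Absolutely continuous curves in `ℝⁿ`. -/

/-- A function whose increments are dominated by those of an absolutely continuous function is
absolutely continuous. -/
theorem AbsolutelyContinuousOnInterval.of_dist_le {X Y : Type*} [PseudoMetricSpace X]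
    [PseudoMetricSpace Y] {f : ℝ → X} {g : ℝ → Y} {a b : ℝ}
    (hg : AbsolutelyContinuousOnInterval g a b)
    (h : ∀ s ∈ uIcc a b, ∀ t ∈ uIcc a b, dist (f s) (f t) ≤ dist (g s) (g t)) :
    AbsolutelyContinuousOnInterval f a b := by
  rw [absolutelyContinuousOnInterval_iff] at hg ⊢
  intro ε hε
  obtain ⟨δ, hδ, H⟩ := hg ε hε
  refine ⟨δ, hδ, fun I hI hI' => lt_of_le_of_lt (Finset.sum_le_sum fun i hi => ?_) (H I hI hI')⟩
  exact h _ (hI.1 i hi).1 _ (hI.1 i hi).2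

/-- The primitive of an integrable vector-valued function is absolutely continuous. -/
theorem IntervalIntegrable.absolutelyContinuousOnInterval_primitive {E : Type*}
    [NormedAddCommGroup E] [NormedSpace ℝ E] {v : ℝ → E} {a b : ℝ} (c : E)
    (hv : IntervalIntegrable v volume a b) :
    AbsolutelyContinuousOnInterval (fun t => c + ∫ s in a..t, v s) a b := by
  refine (hv.norm.absolutelyContinuousOnInterval_intervalIntegral
    (left_mem_uIcc (a := a) (b := b))).of_dist_le fun s hs t ht => ?_
  have hs' : IntervalIntegrable v volume a s := hv.mono_set (uIcc_subset_uIcc left_mem_uIcc hs)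
  have ht' : IntervalIntegrable v volume a t := hv.mono_set (uIcc_subset_uIcc left_mem_uIcc ht)
  rw [dist_add_left, dist_eq_norm, Real.dist_eq,
    intervalIntegral.integral_interval_sub_left hs' ht',
    intervalIntegral.integral_interval_sub_left hs'.norm ht'.norm]
  exact intervalIntegral.norm_integral_le_abs_integral_norm

/-- The primitive of an integrable function is differentiable almost everywhere. -/
theorem IntervalIntegrable.ae_deriv_primitive {E : Type*} [NormedAddCommGroup E]
    [NormedSpace ℝ E] [CompleteSpace E] {v : ℝ → E} {a b : ℝ} (c : E) (hab : a ≤ b)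
    (hv : IntervalIntegrable v volume a b) :
    ∀ᵐ t ∂(volume.restrict (Icc a b)), deriv (fun t => c + ∫ s in a..t, v s) t = v t := by
  rw [ae_restrict_iff' measurableSet_Icc]
  filter_upwards [hv.ae_hasDerivAt_integral] with t ht htm
  rw [uIcc_of_le hab] at ht
  exact ((ht htm a (left_mem_Icc.2 hab)).const_add c).deriv

section Euclidean

variable {n : ℕ} {f : ℝ → EuclideanSpace ℝ (Fin n)} {a b : ℝ}

theorem AbsolutelyContinuousOnInterval.ae_differentiableAt_euclidean
    (hf : AbsolutelyContinuousOnInterval f a b) :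
    ∀ᵐ t, t ∈ uIcc a b → DifferentiableAt ℝ f t :=
  hf.boundedVariationOn.ae_differentiableAt_of_mem_uIcc

theorem AbsolutelyContinuousOnInterval.intervalIntegrable_deriv_euclidean
    (hf : AbsolutelyContinuousOnInterval f a b) :
    IntervalIntegrable (deriv f) volume a b := by
  have hcoord : ∀ i, IntervalIntegrable (deriv fun t => f t i) volume a b := fun i =>
    (hf.of_dist_le fun s _ t _ => by
      rw [Real.dist_eq, dist_eq_norm]
      exact PiLp.norm_apply_le (f s - f t) i :
      AbsolutelyContinuousOnInterval (fun t => f t i) a b).intervalIntegrable_deriv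
  -- The sum of the absolute values of the coordinates dominates the Euclidean norm, which reduces
  -- the claim to scalar functions.
  have hsum : IntervalIntegrable (fun t => ∑ i, |deriv (fun s => f s i) t|) volume a b := by
    have := IntervalIntegrable.sum (Finset.univ) (fun i _ => (hcoord i).norm)
    simpa only [Finset.sum_fn, Real.norm_eq_abs] using this
  refine hsum.mono_fun (measurable_deriv f).aestronglyMeasurable ?_
  filter_upwards [ae_restrict_of_ae (s := uIoc a b) hf.ae_differentiableAt_euclidean,
    ae_restrict_mem measurableSet_uIoc] with t ht htm
  have hd := (ht (uIoc_subset_uIcc htm)).hasDerivAt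
  have hi : ∀ i, deriv (fun s => f s i) t = deriv f t i := fun i =>
    ((EuclideanSpace.proj (𝕜 := ℝ) i).hasFDerivAt.comp_hasDerivAt t hd).deriv
  simp only [hi]
  rw [Real.norm_of_nonneg (Finset.sum_nonneg fun i _ => abs_nonneg _), EuclideanSpace.norm_eq]
  refine Real.sqrt_le_iff.2 ⟨Finset.sum_nonneg fun i _ => abs_nonneg _, ?_⟩
  exact Finset.sum_sq_le_sq_sum_of_nonneg fun i _ => abs_nonneg _

/-- The fundamental theorem of calculus for absolutely continuous curves in `ℝⁿ`. -/
theorem AbsolutelyContinuousOnInterval.eq_add_integral_deriv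
    (hf : AbsolutelyContinuousOnInterval f a b) {t : ℝ} (ht : t ∈ uIcc a b) :
    f t = f a + ∫ s in a..t, deriv f s := by
  have hd := hf.intervalIntegrable_deriv_euclidean
  -- `f` minus the primitive of its derivative is absolutely continuous with zero derivative almost
  -- everywhere, hence constant.
  obtain ⟨C, hC⟩ := (hf.fun_sub
    (hd.absolutelyContinuousOnInterval_primitive (f a))).const_of_ae_hasDerivAt_zero (by
      filter_upwards [hf.ae_differentiableAt_euclidean, hd.ae_hasDerivAt_integral] with t h1 h2 h3
      have := (h1 h3).hasDerivAt.fun_sub ((h2 h3 a left_mem_uIcc).const_add (f a))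
      rwa [sub_self] at this)
  have h0 := hC a left_mem_uIcc
  have h1 := hC t ht
  simp only [intervalIntegral.integral_same, add_zero, sub_self] at h0
  rw [← h0] at h1
  exact sub_eq_zero.1 h1

end Euclidean

/-! ### Measurability and approximate selections. -/

/-- A function that is measurable in the first and `1`-Lipschitz in the second variable is
measurable along every measurable curve. -/
theorem aemeasurable_comp_of_lipschitzWith_one {α X : Type*} [MeasurableSpace α]
    [PseudoMetricSpace X] [TopologicalSpace.SeparableSpace X] [MeasurableSpace X]
    [OpensMeasurableSpace X] {μ : Measure α} {g : α → X → ℝ} (hg0 : ∀ t p, 0 ≤ g t p)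
    (hg : ∀ t, LipschitzWith 1 (g t)) (hm : ∀ p, AEMeasurable (fun t => g t p) μ)
    {z : α → X} (hz : AEMeasurable z μ) : AEMeasurable (fun t => g t (z t)) μ := by
  rcases isEmpty_or_nonempty α with hα | ⟨⟨t₀⟩⟩
  · exact (measurable_of_empty _).aemeasurable
  have : Nonempty X := ⟨z t₀⟩
  -- A `1`-Lipschitz function equals its inf-convolution with the distance, and the infimum may be
  -- taken over a dense sequence; each term is then measurable.
  have key : (fun t => g t (z t)) =
      fun t => ⨅ i : ℕ, (g t (TopologicalSpace.denseSeq X i) +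
        dist (z t) (TopologicalSpace.denseSeq X i)) := by
    funext t
    have hle : ∀ p q, g t p ≤ g t q + dist p q := fun p q => by
      have := (hg t).dist_le_mul p q
      rw [Real.dist_eq, NNReal.coe_one, one_mul] at this
      linarith [le_abs_self (g t p - g t q)]
    refine le_antisymm (le_ciInf fun i => hle _ _) (le_of_forall_pos_le_add fun ε hε => ?_)
    obtain ⟨i, hi⟩ := (TopologicalSpace.denseRange_denseSeq X).exists_dist_lt (z t) (half_pos hε)
    refine (ciInf_le ⟨0, ?_⟩ i).trans ?_
    · rintro _ ⟨j, rfl⟩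
      exact add_nonneg (hg0 _ _) dist_nonneg
    · have := hle (TopologicalSpace.denseSeq X i) (z t)
      rw [dist_comm] at this
      linarith
  rw [key]
  exact AEMeasurable.iInf fun i => (hm _).add
    ((measurable_id.dist measurable_const).comp_aemeasurable hz)

/-- If countably many null-measurable sets `S i` cover almost everything, an index `i` with
`t ∈ S i` can be chosen measurably. -/
theorem exists_measurable_selection_of_countable_cover {α β : Type*} [MeasurableSpace α]
    [MeasurableSpace β] {μ : Measure α} {S : ℕ → Set α} (hS : ∀ i, NullMeasurableSet (S i) μ)
    (hcov : ∀ᵐ t ∂μ, ∃ i, t ∈ S i) (d : ℕ → β) :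
    ∃ w : α → β, Measurable w ∧ ∀ᵐ t ∂μ, ∃ i, t ∈ S i ∧ w t = d i := by
  classical
  let S' : ℕ → Set α := fun i => toMeasurable μ (S i)
  have hS' : ∀ i, MeasurableSet (S' i) := fun i => measurableSet_toMeasurable _ _
  -- Adding the uncovered set to every `S' i` makes `Nat.find` total without affecting covered
  -- points.
  have hp : ∀ t, ∃ i, t ∈ S' i ∪ (⋃ j, S' j)ᶜ := fun t => by
    by_cases h : t ∈ ⋃ j, S' j
    · obtain ⟨i, hi⟩ := mem_iUnion.1 h
      exact ⟨i, Or.inl hi⟩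
    · exact ⟨0, Or.inr h⟩
  refine ⟨fun t => d (Nat.find (hp t)), Measurable.find (f := fun i _ => d i)
    (p := fun i t => t ∈ S' i ∪ (⋃ j, S' j)ᶜ)
    (fun i => measurable_const) (fun i => (hS' i).union (MeasurableSet.iUnion hS').compl) hp, ?_⟩
  have hae : ∀ᵐ t ∂μ, ∀ i, t ∈ S' i ↔ t ∈ S i :=
    ae_all_iff.2 fun i => (hS i).toMeasurable_ae_eq.mem_iff
  filter_upwards [hcov, hae] with t ⟨i, hi⟩ ht
  refine ⟨Nat.find (hp t), (ht _).1 ?_, rfl⟩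
  rcases Nat.find_spec (hp t) with h | h
  · exact h
  · exact absurd (mem_iUnion.2 ⟨i, (ht i).2 hi⟩) h

/-- Approximate measurable selection: if, almost everywhere, the open condition `g t y < β t`,
`‖y - v t‖ < b t` can be satisfied, then it can be satisfied measurably in `t`. -/
theorem exists_measurable_approx_selection {α E : Type*} [MeasurableSpace α]
    [NormedAddCommGroup E] [TopologicalSpace.SeparableSpace E] [MeasurableSpace E]
    [BorelSpace E] {μ : Measure α} {g : α → E → ℝ}
    (hg : ∀ t, Continuous (g t)) (hm : ∀ y, AEMeasurable (fun t => g t y) μ)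
    {β b : α → ℝ} (hβ : AEMeasurable β μ) (hb : AEMeasurable b μ) {v : α → E}
    (hv : AEMeasurable v μ) (hex : ∀ᵐ t ∂μ, ∃ y, g t y < β t ∧ dist y (v t) < b t) :
    ∃ w : α → E, Measurable w ∧ ∀ᵐ t ∂μ, g t (w t) < β t ∧ dist (w t) (v t) < b t := by
  let d := TopologicalSpace.denseSeq E
  obtain ⟨w, hw, hwS⟩ := exists_measurable_selection_of_countable_cover (μ := μ)
    (S := fun i => {t | g t (d i) < β t} ∩ {t | dist (d i) (v t) < b t}) (fun i =>
      (nullMeasurableSet_lt (hm _) hβ).inter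
        (nullMeasurableSet_lt ((measurable_const.dist measurable_id).comp_aemeasurable hv) hb))
    (by
      filter_upwards [hex] with t ⟨y, hy⟩
      have hopen : IsOpen ({y | g t y < β t} ∩ {y | dist y (v t) < b t}) :=
        (isOpen_lt (hg t) continuous_const).inter
          (isOpen_lt (continuous_id.dist continuous_const) continuous_const)
      obtain ⟨_, hz, i, rfl⟩ :=
        (TopologicalSpace.denseRange_denseSeq E).inter_open_nonempty _ hopen ⟨y, hy⟩
      exact ⟨i, hz⟩) d
  refine ⟨w, hw, ?_⟩
  filter_upwards [hwS] with t ⟨i, hi, hwi⟩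
  rw [hwi]
  exact hi

/-! ### Distance to the graph versus distance to the values. -/

namespace DiffIncl

variable {n : ℕ}

section Graph

variable {U : Set (Euc n)} {G : Euc n → Set (Euc n)} {κ : ℝ}

theorem graph_nonempty {x : Euc n} (h : (G x).Nonempty) : (graph G).Nonempty :=
  let ⟨y, hy⟩ := h
  ⟨(x, y), hy⟩

/-- Nonemptiness is essential because `Metric.infDist` to the empty set is `0`. Since the graph is
closed only relative to `U ×ˢ univ`, openness of `U` is used to localize the closure. -/
theorem mem_of_infDist_graph_eq_zero (hU : IsOpen U) (hG : ClosedGraphOver U G) {x y : Euc n}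
    (hx : x ∈ U) (hne : (G x).Nonempty) (h : Metric.infDist (x, y) (graph G) = 0) : y ∈ G x := by
  obtain ⟨C, hC, hCG⟩ := hG
  have hcl : (x, y) ∈ closure (graph G) :=
    (Metric.mem_closure_iff_infDist_zero (graph_nonempty hne)).2 h
  have hmem : (x, y) ∈ U ×ˢ (univ : Set (Euc n)) := ⟨hx, mem_univ _⟩
  have hcl' : (x, y) ∈ closure (U ×ˢ (univ : Set (Euc n)) ∩ graph G) :=
    (hU.prod isOpen_univ).inter_closure ⟨hmem, hcl⟩
  have : (x, y) ∈ C :=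
    closure_minimal (by rw [inter_comm, hCG]; exact inter_subset_left) hC hcl'
  exact (hCG.symm.subset ⟨this, hmem⟩).1

/-- Finiteness in `HausdorffLE` matters: `Metric.hausdorffDist` is `0` when the extended distance is
infinite. -/
theorem infDist_le_infDist_add_of_hausdorffLE {P Q : Set (Euc n)} {c : ℝ} (h : HausdorffLE P Q c)
    (y : Euc n) : Metric.infDist y Q ≤ Metric.infDist y P + c :=
  (Metric.infDist_le_infDist_add_hausdorffDist h.1).trans (add_le_add_right h.2 _)

/-- For a Lipschitz set-valued map, a point close to the graph is close to the value of the map. -/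
theorem infDist_le_of_infDist_graph_lt (hκ : 0 ≤ κ)
    (hG : ∀ x ∈ U, ∀ x' ∈ U, HausdorffLE (G x) (G x') (κ * ‖x - x'‖)) {x y : Euc n} {σ : ℝ}
    (hx : x ∈ U) (hσ : Metric.ball x σ ⊆ U) (hne : (G x).Nonempty)
    (h : Metric.infDist (x, y) (graph G) < σ) : Metric.infDist y (G x) ≤ (1 + κ) * σ := by
  obtain ⟨⟨x', y'⟩, hmem, hd⟩ := (Metric.infDist_lt_iff (graph_nonempty hne)).1 h
  rw [Prod.dist_eq, max_lt_iff] at hd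
  simp only at hd
  have hx' : x' ∈ U := hσ (by rw [Metric.mem_ball, dist_comm]; exact hd.1)
  have h1 := infDist_le_infDist_add_of_hausdorffLE (hG x' hx' x hx) y
  have h2 : Metric.infDist y (G x') ≤ dist y y' := Metric.infDist_le_dist_of_mem hmem
  have h3 : κ * ‖x' - x‖ ≤ κ * σ := by
    rw [← dist_eq_norm, dist_comm]
    exact mul_le_mul_of_nonneg_left hd.1.le hκ
  linarith [hd.2]

end Graph

/-- The standing assumptions of Filippov's theorem on `[0, τ]`. -/
structure IsFilippov (U : Set (Euc n)) (F : ℝ → Euc n → Set (Euc n)) (k : ℝ → ℝ) (τ : ℝ) :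
    Prop where
  isOpen : IsOpen U
  nonempty : ∀ᵐ t ∂(volume.restrict (Icc 0 τ)), ∀ x ∈ U, (F t x).Nonempty
  closed : ∀ᵐ t ∂(volume.restrict (Icc 0 τ)), ClosedGraphOver U (F t)
  measurable : ∀ x y : Euc n,
    AEMeasurable (fun t => Metric.infDist (x, y) (graph (F t))) (volume.restrict (Icc 0 τ))
  integrable : IntegrableOn k (Icc 0 τ)
  nonneg : ∀ᵐ t ∂(volume.restrict (Icc 0 τ)), 0 ≤ k t
  lipschitz : ∀ᵐ t ∂(volume.restrict (Icc 0 τ)), ∀ x ∈ U, ∀ x' ∈ U,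
    HausdorffLE (F t x) (F t x') (k t * ‖x - x'‖)

/-! ### Velocities in `L¹` and their curves. -/

/-- The space of integrable velocities on `[0, τ]`. -/
abbrev Velocity (n : ℕ) (τ : ℝ) : Type := Lp (Euc n) 1 (volume.restrict (Icc 0 τ))

/-- The curve with initial value `a` and velocity `v`. -/
noncomputable def curve (a : Euc n) (v : ℝ → Euc n) (t : ℝ) : Euc n :=
  a + ∫ s in (0 : ℝ)..t, v s

section Velocity

variable {τ : ℝ}

theorem Velocity.integrableOn (v : Velocity n τ) : IntegrableOn v (Icc 0 τ) :=
  L1.integrable_coeFn v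

theorem Velocity.intervalIntegrable (hτ : 0 ≤ τ) (v : Velocity n τ) :
    IntervalIntegrable v volume 0 τ :=
  (intervalIntegrable_iff_integrableOn_Icc_of_le hτ).2 v.integrableOn

theorem Velocity.norm_sub_eq (u v : Velocity n τ) :
    ‖u - v‖ = ∫ t in Icc 0 τ, ‖u t - v t‖ := by
  rw [L1.norm_eq_integral_norm]
  refine integral_congr_ae ?_
  filter_upwards [Lp.coeFn_sub u v] with t ht
  rw [ht, Pi.sub_apply]

/-- Integration is `1`-Lipschitz from `L¹` to the uniform norm; this is what turns a step length
into a bound on the next defect. -/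
theorem Velocity.norm_curve_sub_le (a : Euc n) (u v : Velocity n τ) {t : ℝ} (ht : t ∈ Icc 0 τ) :
    ‖curve a u t - curve a v t‖ ≤ ‖u - v‖ := by
  have hsub : Ioc 0 t ⊆ Icc 0 τ := fun s hs => ⟨hs.1.le, hs.2.trans ht.2⟩
  have hint : ∀ w : Velocity n τ, IntervalIntegrable w volume 0 t := fun w =>
    (intervalIntegrable_iff_integrableOn_Ioc_of_le ht.1).2 (w.integrableOn.mono_set hsub)
  rw [curve, curve, add_sub_add_left_eq_sub, ← intervalIntegral.integral_sub (hint u) (hint v),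
    Velocity.norm_sub_eq]
  refine (intervalIntegral.norm_integral_le_integral_norm ht.1).trans ?_
  rw [intervalIntegral.integral_of_le ht.1]
  exact setIntegral_mono_set (u.integrableOn.sub v.integrableOn).norm
    (Filter.Eventually.of_forall fun _ => norm_nonneg _) hsub.eventuallyLE

theorem Velocity.absolutelyContinuous_curve (hτ : 0 ≤ τ) (a : Euc n) (v : Velocity n τ) :
    AbsolutelyContinuousOnInterval (curve a v) 0 τ :=
  (v.intervalIntegrable hτ).absolutelyContinuousOnInterval_primitive a

theorem Velocity.continuousOn_curve (hτ : 0 ≤ τ) (a : Euc n) (v : Velocity n τ) :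
    ContinuousOn (curve a v) (Icc 0 τ) := by
  have := (v.absolutelyContinuous_curve hτ a).continuousOn
  rwa [uIcc_of_le hτ] at this

end Velocity

/-! ### Choosing the next velocity. -/

section Step

variable {U : Set (Euc n)} {F : ℝ → Euc n → Set (Euc n)} {k : ℝ → ℝ} {τ : ℝ}

/-- Given a curve `x` in `U` and a velocity `v` whose distance to `F(t, x(t))` is at most `b(t)`,
there is a velocity `w` which almost lies in `F(t, x(t))` and whose distance to `v` is almost at
most `b`. -/
theorem IsFilippov.exists_velocity (H : IsFilippov U F k τ) (hτ : 0 ≤ τ) {x : ℝ → Euc n}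
    (hx : ContinuousOn x (Icc 0 τ)) {δ : ℝ} (hδ : 0 < δ)
    (hball : ∀ t ∈ Icc 0 τ, Metric.ball (x t) δ ⊆ U) (v : Velocity n τ) {b : ℝ → ℝ}
    (hb : IntegrableOn b (Icc 0 τ))
    (hvb : ∀ᵐ t ∂(volume.restrict (Icc 0 τ)), Metric.infDist (v t) (F t (x t)) ≤ b t)
    {η : ℝ} (hη : 0 < η) :
    ∃ w : Velocity n τ,
      (∀ᵐ t ∂(volume.restrict (Icc 0 τ)), Metric.infDist (x t, w t) (graph (F t)) < η) ∧
      (∀ᵐ t ∂(volume.restrict (Icc 0 τ)), Metric.infDist (w t) (F t (x t)) ≤ η) ∧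
      ‖w - v‖ ≤ (∫ t in Icc 0 τ, b t) + τ * η := by
  have hmem : ∀ᵐ t ∂(volume.restrict (Icc 0 τ)), t ∈ Icc 0 τ := ae_restrict_mem measurableSet_Icc
  have hxU : ∀ t ∈ Icc 0 τ, x t ∈ U := fun t ht => hball t ht (Metric.mem_ball_self hδ)
  -- The bound `δ` keeps the base point of a nearby graph point inside `U`; the bound `η / (1 + k
  -- t)` absorbs the factor `1 + k t` lost in passing from the graph to the value `F t (x t)`.
  let β : ℝ → ℝ := fun t => min δ (η / (1 + k t))
  obtain ⟨w, hw, hwae⟩ := exists_measurable_approx_selection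
    (g := fun t y => Metric.infDist (x t, y) (graph (F t))) (v := v) (β := β)
    (b := fun t => b t + η) (μ := volume.restrict (Icc 0 τ))
    (fun t => (Metric.continuous_infDist_pt _).comp (by fun_prop))
    (fun y => aemeasurable_comp_of_lipschitzWith_one (z := fun t => (x t, y))
      (g := fun t p => Metric.infDist p (graph (F t))) (fun _ _ => Metric.infDist_nonneg)
      (fun t => Metric.lipschitz_infDist_pt _) (fun p => H.measurable p.1 p.2)
      ((hx.aemeasurable measurableSet_Icc).prodMk aemeasurable_const))
    (aemeasurable_const.min (aemeasurable_const.div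
      (aemeasurable_const.add H.integrable.aemeasurable)))
    (hb.aemeasurable.add aemeasurable_const)
    v.integrableOn.aemeasurable (by
      filter_upwards [hmem, H.nonempty, hvb, H.nonneg] with t ht hne hvt hk
      obtain ⟨y, hy, hyd⟩ := (Metric.infDist_lt_iff (hne _ (hxU t ht))).1
        (lt_of_le_of_lt hvt (lt_add_of_pos_right (b t) hη))
      refine ⟨y, ?_, by rwa [dist_comm]⟩
      rw [Metric.infDist_zero_of_mem (show (x t, y) ∈ graph (F t) from hy)]
      exact lt_min hδ (by positivity))
  have hdiff : Integrable (fun t => w t - v t) (volume.restrict (Icc 0 τ)) := by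
    refine Integrable.mono' (hb.add (integrable_const η))
      (hw.aestronglyMeasurable.sub (Lp.aestronglyMeasurable v)) ?_
    filter_upwards [hwae] with t ht
    rw [← dist_eq_norm]
    exact ht.2.le
  have hwint : Integrable w (volume.restrict (Icc 0 τ)) := by
    have := Integrable.fun_add hdiff v.integrableOn
    simpa using this
  refine ⟨hwint.toL1 w, ?_, ?_, ?_⟩
  · filter_upwards [hwae, hwint.coeFn_toL1, H.nonneg] with t ht hwt hk
    rw [hwt]
    exact ht.1.trans_le ((min_le_right _ _).trans (div_le_self hη.le (by linarith)))
  · filter_upwards [hmem, hwae, hwint.coeFn_toL1, H.nonneg, H.lipschitz, H.nonempty] with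
      t htm ht hwt hk hlip hne
    rw [hwt]
    refine (infDist_le_of_infDist_graph_lt hk hlip (hxU t htm)
      ((Metric.ball_subset_ball (min_le_left _ _)).trans (hball t htm))
      (hne _ (hxU t htm)) ht.1).trans ?_
    calc (1 + k t) * β t ≤ (1 + k t) * (η / (1 + k t)) :=
          mul_le_mul_of_nonneg_left (min_le_right _ _) (by linarith)
      _ = η := mul_div_cancel₀ _ (by linarith)
  · rw [Velocity.norm_sub_eq]
    calc ∫ t in Icc 0 τ, ‖hwint.toL1 w t - v t‖ ≤ ∫ t in Icc 0 τ, (b t + η) := by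
          refine integral_mono_ae ((Velocity.integrableOn (hwint.toL1 w)).sub v.integrableOn).norm
            (hb.add (integrable_const η)) ?_
          filter_upwards [hwae, hwint.coeFn_toL1] with t ht hwt
          rw [hwt, ← dist_eq_norm]
          exact ht.2.le
      _ = (∫ t in Icc 0 τ, b t) + τ * η := by
          rw [integral_add hb (integrable_const η)]
          simp [hτ]

end Step

end DiffIncl

/-! ### Filippov's iteration and its limit. -/

namespace DiffIncl

variable {n : ℕ} {U : Set (Euc n)} {F : ℝ → Euc n → Set (Euc n)} {k : ℝ → ℝ} {τ : ℝ}

/-- An approximate solution reached by Filippov's iteration: `length` bounds the distance in `L¹`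
covered by the velocities so far, `defectBound` bounds the defect of the current curve, and
`error` bounds the error allowed in the next step. The field `budget` says that the total
distance of this and all later velocities from `v₀` is at most `R`. -/
structure ApproxSolution (F : ℝ → Euc n → Set (Euc n)) (k : ℝ → ℝ) (a : Euc n)
    (v₀ : Velocity n τ) (R : ℝ) where
  velocity : Velocity n τ
  defectBound : ℝ → ℝ
  length : ℝ
  error : ℝ
  norm_sub_le : ‖velocity - v₀‖ ≤ length
  integrable : IntegrableOn defectBound (Icc 0 τ)
  defect_le : ∀ᵐ t ∂(volume.restrict (Icc 0 τ)),
    Metric.infDist (velocity t) (F t (curve a velocity t)) ≤ defectBound t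
  error_pos : 0 < error
  budget : length + ((∫ t in Icc 0 τ, defectBound t) + 4 * τ * error) /
    (1 - ∫ t in Icc 0 τ, k t) ≤ R

namespace ApproxSolution

variable {a : Euc n} {v₀ : Velocity n τ} {R : ℝ}

theorem length_le (p : ApproxSolution F k a v₀ R) (hτ : 0 ≤ τ)
    (hK : ∫ t in Icc 0 τ, k t < 1) : p.length ≤ R := by
  have h1 : 0 ≤ ∫ t in Icc 0 τ, p.defectBound t := integral_nonneg_of_ae (by
    filter_upwards [p.defect_le] with t ht
    exact Metric.infDist_nonneg.trans ht)
  have h2 := p.error_pos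
  have h3 := p.budget
  have h4 : 0 ≤ ((∫ t in Icc 0 τ, p.defectBound t) + 4 * τ * p.error) /
      (1 - ∫ t in Icc 0 τ, k t) := div_nonneg (by positivity) (by linarith)
  linarith

theorem norm_curve_sub_le (p : ApproxSolution F k a v₀ R) (hτ : 0 ≤ τ)
    (hK : ∫ t in Icc 0 τ, k t < 1) {t : ℝ} (ht : t ∈ Icc 0 τ) :
    ‖curve a p.velocity t - curve a v₀ t‖ ≤ R :=
  (Velocity.norm_curve_sub_le a _ _ ht).trans (p.norm_sub_le.trans (p.length_le hτ hK))

/-- One step of Filippov's iteration. -/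
theorem exists_next (H : IsFilippov U F k τ) (hτ : 0 ≤ τ) (hK : ∫ t in Icc 0 τ, k t < 1)
    {δ : ℝ} (hδ : 0 < δ) (hball : ∀ t ∈ Icc 0 τ, Metric.ball (curve a v₀ t) (R + δ) ⊆ U)
    (p : ApproxSolution F k a v₀ R) :
    ∃ q : ApproxSolution F k a v₀ R, q.length = p.length + ‖q.velocity - p.velocity‖ ∧
      q.error = p.error / 2 ∧ ∀ᵐ t ∂(volume.restrict (Icc 0 τ)),
        Metric.infDist (curve a p.velocity t, q.velocity t) (graph (F t)) < p.error := by
  have hballp : ∀ q : ApproxSolution F k a v₀ R, ∀ t ∈ Icc 0 τ,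
      Metric.ball (curve a q.velocity t) δ ⊆ U := fun q t ht =>
    (Metric.ball_subset_ball' (by
      have := q.norm_curve_sub_le hτ hK ht
      rw [dist_eq_norm]
      linarith)).trans (hball t ht)
  obtain ⟨w, hwg, hwd, hwn⟩ := H.exists_velocity hτ (p.velocity.continuousOn_curve hτ a) hδ
    (hballp p) p.velocity p.integrable p.defect_le p.error_pos
  have hK' : 0 < 1 - ∫ t in Icc 0 τ, k t := by linarith
  set D := ‖w - p.velocity‖ with hD
  -- With error `e`, `D ≤ ∫ b + τ e`. After multiplying by `1 - K`, the terms in `K * D` cancel and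
  -- `D + τ e + 2 τ e ≤ ∫ b + 4 τ e` remains, whence the factor `4`.
  have hbudget : p.length + D + (τ * p.error + (∫ t in Icc 0 τ, k t) * D +
      4 * τ * (p.error / 2)) / (1 - ∫ t in Icc 0 τ, k t) ≤ R := by
    refine le_trans ?_ p.budget
    rw [add_assoc, add_le_add_iff_left, le_div_iff₀ hK', add_mul, div_mul_cancel₀ _ hK'.ne']
    linarith
  have hlen : ‖w - v₀‖ ≤ p.length + D := by
    have := norm_sub_le_norm_sub_add_norm_sub w p.velocity v₀
    linarith [p.norm_sub_le]
  have hkD : IntegrableOn (fun t => k t * D) (Icc 0 τ) := H.integrable.mul_const D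
  have hK0 : 0 ≤ ∫ t in Icc 0 τ, k t := integral_nonneg_of_ae H.nonneg
  have hwR : ‖w - v₀‖ ≤ R := by
    refine hlen.trans (le_trans (le_add_of_nonneg_right (div_nonneg ?_ hK'.le)) hbudget)
    have := p.error_pos
    positivity
  have hwU : ∀ t ∈ Icc 0 τ, curve a w t ∈ U := fun t ht => hball t ht (by
    rw [Metric.mem_ball, dist_eq_norm]
    linarith [Velocity.norm_curve_sub_le a w v₀ ht])
  refine ⟨⟨w, fun t => p.error + k t * D, p.length + D, p.error / 2, hlen,
    (integrable_const _).add hkD, ?_, half_pos p.error_pos, ?_⟩, rfl, rfl, hwg⟩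
  · filter_upwards [hwd, H.lipschitz, H.nonneg, ae_restrict_mem measurableSet_Icc] with
      t ht hlip hk htm
    have h1 := infDist_le_infDist_add_of_hausdorffLE (hlip _
      (hballp p t htm (Metric.mem_ball_self hδ)) _ (hwU t htm)) (w t)
    have h2 : k t * ‖curve a p.velocity t - curve a w t‖ ≤ k t * D := by
      rw [norm_sub_rev]
      exact mul_le_mul_of_nonneg_left (Velocity.norm_curve_sub_le a _ _ htm) hk
    linarith
  · rw [integral_add (integrable_const _) hkD, integral_mul_const]
    simpa [hτ] using hbudget

end ApproxSolution

/-- **Filippov's theorem** in terms of velocities. -/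
theorem IsFilippov.exists_velocity_mem (H : IsFilippov U F k τ) (hτ : 0 ≤ τ)
    (hK : ∫ t in Icc 0 τ, k t < 1) {a : Euc n} {v₀ : Velocity n τ} {R δ : ℝ} (hδ : 0 < δ)
    (hball : ∀ t ∈ Icc 0 τ, Metric.ball (curve a v₀ t) (R + δ) ⊆ U)
    (p₀ : ApproxSolution F k a v₀ R) :
    ∃ v : Velocity n τ, ‖v - v₀‖ ≤ R ∧
      ∀ᵐ t ∂(volume.restrict (Icc 0 τ)), v t ∈ F t (curve a v t) := by
  choose next hlen herr hgraph using ApproxSolution.exists_next H hτ hK hδ hball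
  let p : ℕ → ApproxSolution F k a v₀ R := fun j => next^[j] p₀
  have hp : ∀ j, p (j + 1) = next (p j) := fun j => Function.iterate_succ_apply' _ _ _
  have herror : ∀ j, (p j).error = p₀.error * (1 / 2) ^ j := by
    intro j
    induction j with
    | zero => simp [p]
    | succ j ih => rw [hp, herr, ih, pow_succ]; ring
  have hlength : ∀ j, p₀.length + ∑ i ∈ Finset.range j,
      ‖(p (i + 1)).velocity - (p i).velocity‖ = (p j).length := by
    intro j
    induction j with
    | zero => simp [p]
    | succ j ih => rw [Finset.sum_range_succ, ← add_assoc, ih, hp, hlen]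
  -- The partial sums are increments of `length`, which never exceeds `R`.
  have hsum : Summable fun j => dist (p j).velocity (p j.succ).velocity := by
    refine summable_of_sum_range_le (c := R - p₀.length) (fun _ => dist_nonneg) fun j => ?_
    have hdist : ∀ i, dist (p i).velocity (p i.succ).velocity =
        ‖(p (i + 1)).velocity - (p i).velocity‖ := fun i => by rw [dist_comm, dist_eq_norm]
    simp only [hdist]
    linarith [hlength j, (p j).length_le hτ hK]
  obtain ⟨v, hv⟩ := cauchySeq_tendsto_of_complete (cauchySeq_of_summable_dist hsum)
  have hvR : ‖v - v₀‖ ≤ R := le_of_tendsto (hv.sub_const v₀).norm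
    (Filter.Eventually.of_forall fun j => (p j).norm_sub_le.trans ((p j).length_le hτ hK))
  refine ⟨v, hvR, ?_⟩
  -- The shift by one pairs velocity `j + 1` with curve `j`, the pair known to be near the graph.
  -- Velocities need a subsequence to converge almost everywhere; the curves converge uniformly.
  obtain ⟨ns, hns, hlim⟩ := (tendstoInMeasure_of_tendsto_Lp
    (hv.comp (Filter.tendsto_add_atTop_nat 1))).exists_seq_tendsto_ae
  have hgraph' : ∀ᵐ t ∂(volume.restrict (Icc 0 τ)), ∀ j, Metric.infDist
      (curve a (p j).velocity t, (p (j + 1)).velocity t) (graph (F t)) <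
        p₀.error * (1 / 2) ^ j :=
    ae_all_iff.2 fun j => by
      rw [← herror, hp]
      exact hgraph (p j)
  filter_upwards [hlim, hgraph', H.closed, H.nonempty, ae_restrict_mem measurableSet_Icc] with
    t hlt hgt hcl hne ht
  have hcurve : Filter.Tendsto (fun j => curve a (p j).velocity t) Filter.atTop
      (nhds (curve a v t)) := by
    rw [tendsto_iff_norm_sub_tendsto_zero] at hv ⊢
    exact squeeze_zero (fun _ => norm_nonneg _)
      (fun j => Velocity.norm_curve_sub_le a (p j).velocity v ht) hv
  have hU : curve a v t ∈ U := hball t ht (by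
    rw [Metric.mem_ball, dist_eq_norm]
    linarith [Velocity.norm_curve_sub_le a v v₀ ht])
  refine mem_of_infDist_graph_eq_zero H.isOpen hcl hU (hne _ hU) ?_
  have hlim1 := ((Metric.continuous_infDist_pt (graph (F t))).tendsto _).comp
    ((hcurve.comp hns.tendsto_atTop).prodMk_nhds hlt)
  have hlim2 : Filter.Tendsto (fun j => p₀.error * (1 / 2 : ℝ) ^ ns j) Filter.atTop (nhds 0) := by
    have := (tendsto_pow_atTop_nhds_zero_of_lt_one (r := (1 / 2 : ℝ)) (by norm_num)
      (by norm_num)).const_mul p₀.error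
    rw [mul_zero] at this
    exact this.comp hns.tendsto_atTop
  exact le_antisymm (le_of_tendsto_of_tendsto' hlim1 hlim2 fun j => (hgt (ns j)).le)
    Metric.infDist_nonneg

end DiffIncl

/-! ### Solutions, the sign of `k`, and small times. -/

namespace DiffIncl

variable {n : ℕ} {U : Set (Euc n)} {F : ℝ → Euc n → Set (Euc n)} {k : ℝ → ℝ} {τ : ℝ}

theorem mem_of_infDist_eq_zero {G : Euc n → Set (Euc n)} (hU : IsOpen U)
    (hG : ClosedGraphOver U G) {x y : Euc n} (hx : x ∈ U) (hne : (G x).Nonempty)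
    (h : Metric.infDist y (G x) = 0) : y ∈ G x := by
  refine mem_of_infDist_graph_eq_zero hU hG hx hne (le_antisymm ?_ Metric.infDist_nonneg)
  refine le_of_forall_pos_le_add fun ε hε => ?_
  obtain ⟨y', hy', hd⟩ := (Metric.infDist_lt_iff hne).1 (h.trans_lt hε)
  refine (Metric.infDist_le_dist_of_mem (show (x, y') ∈ graph G from hy')).trans ?_
  rw [Prod.dist_eq, dist_self, zero_add]
  exact max_le hε.le hd.le

/-- **Filippov's theorem** with an arbitrary bound `R` exceeding `ξ / (1 - K)`. -/
theorem IsFilippov.exists_isSolution (H : IsFilippov U F k τ) (hτ : 0 < τ)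
    (hK : ∫ t in Icc 0 τ, k t < 1) {x₀ : ℝ → Euc n} (hx₀ : AbsolutelyContinuousOnInterval x₀ 0 τ)
    (hρ : IntegrableOn (defect F x₀) (Icc 0 τ)) {R δ c : ℝ} (hδ : 0 < δ) (hc : 0 < c)
    (hball : ∀ t ∈ Icc 0 τ, Metric.ball (x₀ t) (R + δ) ⊆ U)
    (hR : ((∫ t in Icc 0 τ, defect F x₀ t) + c) / (1 - ∫ t in Icc 0 τ, k t) ≤ R) :
    ∃ x : ℝ → Euc n, IsSolution F (x₀ 0) τ x ∧ (∀ t ∈ Icc 0 τ, x t ∈ U) ∧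
      IntervalIntegrable (fun t => ‖deriv x t - deriv x₀ t‖) volume 0 τ ∧
      ∫ t in 0..τ, ‖deriv x t - deriv x₀ t‖ ≤ R := by
  have hd : Integrable (deriv x₀) (volume.restrict (Icc 0 τ)) :=
    (intervalIntegrable_iff_integrableOn_Icc_of_le hτ.le).1 hx₀.intervalIntegrable_deriv_euclidean
  let v₀ : Velocity n τ := hd.toL1 (deriv x₀)
  have hv₀ : v₀ =ᵐ[volume.restrict (Icc 0 τ)] deriv x₀ := hd.coeFn_toL1
  have hcurve : ∀ t ∈ Icc 0 τ, curve (x₀ 0) v₀ t = x₀ t := fun t ht => by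
    have hsub : Ioc 0 t ⊆ Icc 0 τ := fun s hs => ⟨hs.1.le, hs.2.trans ht.2⟩
    rw [hx₀.eq_add_integral_deriv (Icc_subset_uIcc ht), curve,
      intervalIntegral.integral_of_le ht.1, intervalIntegral.integral_of_le ht.1]
    congr 1
    exact integral_congr_ae (ae_restrict_of_ae_restrict_of_subset hsub hv₀)
  have hball' : ∀ t ∈ Icc 0 τ, Metric.ball (curve (x₀ 0) v₀ t) (R + δ) ⊆ U := fun t ht => by
    rw [hcurve t ht]
    exact hball t ht
  obtain ⟨v, hvR, hv⟩ := H.exists_velocity_mem hτ.le hK hδ hball'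
    { velocity := v₀
      defectBound := defect F x₀
      length := 0
      -- This makes `4 * τ * error = c`, so the initial budget is exactly `hR`.
      error := c / (4 * τ)
      norm_sub_le := by simp
      integrable := hρ
      defect_le := by
        filter_upwards [hv₀, ae_restrict_mem measurableSet_Icc] with t ht htm
        rw [ht, hcurve t htm, defect]
      error_pos := by positivity
      budget := by
        rwa [zero_add, mul_div_cancel₀ c (by positivity)] }
  have hderiv : ∀ᵐ t ∂(volume.restrict (Icc 0 τ)), deriv (curve (x₀ 0) v) t = v t :=
    (v.intervalIntegrable hτ.le).ae_deriv_primitive (x₀ 0) hτ.le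
  have hdiff : (fun t => ‖v t - v₀ t‖) =ᵐ[volume.restrict (Icc 0 τ)]
      fun t => ‖deriv (curve (x₀ 0) v) t - deriv x₀ t‖ := by
    filter_upwards [hderiv, hv₀] with t h1 h2
    rw [h1, h2]
  refine ⟨curve (x₀ 0) v, ⟨v.absolutelyContinuous_curve hτ.le _, by simp [curve], ?_⟩,
    fun t ht => ?_, ?_, ?_⟩
  · filter_upwards [hv, hderiv] with t h1 h2
    rwa [h2]
  · refine hball t ht ?_
    rw [Metric.mem_ball, dist_eq_norm, ← hcurve t ht]
    linarith [Velocity.norm_curve_sub_le (x₀ 0) v v₀ ht]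
  · exact (intervalIntegrable_iff_integrableOn_Icc_of_le hτ.le).2
      (((v.integrableOn.sub v₀.integrableOn).norm).congr hdiff)
  · rw [intervalIntegral.integral_of_le hτ.le, ← integral_Icc_eq_integral_Ioc,
      ← integral_congr_ae hdiff, ← Velocity.norm_sub_eq]
    exact hvR

/-- The Lipschitz bound between two distinct points of `U` forces the sign; nontriviality of the
space provides the second point. -/
theorem nonneg_of_hausdorffLE [Nontrivial (Euc n)] {G : Euc n → Set (Euc n)} {κ : ℝ}
    (hU : IsOpen U) (hne : U.Nonempty)
    (hG : ∀ x ∈ U, ∀ x' ∈ U, HausdorffLE (G x) (G x') (κ * ‖x - x'‖)) : 0 ≤ κ := by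
  obtain ⟨x, hx⟩ := hne
  have := Module.punctured_nhds_neBot ℝ (Euc n) x
  obtain ⟨y, hyU, hyx⟩ := Filter.nonempty_of_mem
    (Filter.inter_mem (mem_nhdsWithin_of_mem_nhds (hU.mem_nhds hx)) (self_mem_nhdsWithin :
      ({x}ᶜ : Set (Euc n)) ∈ nhdsWithin x {x}ᶜ))
  exact nonneg_of_mul_nonneg_left (Metric.hausdorffDist_nonneg.trans (hG y hyU x hx).2)
    (norm_pos_iff.2 (sub_ne_zero.2 hyx))

theorem ball_subset_of_lt_trajDist {x₀ : ℝ → Euc n} {s : ℝ}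
    (h : ENNReal.ofReal s < trajDist U x₀ τ) {t : ℝ} (ht : t ∈ Icc 0 τ) :
    Metric.ball (x₀ t) s ⊆ U := by
  intro y hy
  by_contra hyU
  have h1 : trajDist U x₀ τ ≤ edist (x₀ t) y :=
    (iInf₂_le t ht).trans (Metric.infEDist_le_edist_of_mem hyU)
  rw [edist_dist] at h1
  have h2 := lt_of_not_ge fun h' => (h.trans_le h1).not_ge (ENNReal.ofReal_le_ofReal h')
  rw [Metric.mem_ball, dist_comm] at hy
  exact lt_asymm h2 hy

/-- A continuous curve in an open set stays away from the complement of that set. -/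
theorem exists_pos_le_trajDist (hU : IsOpen U) {x₀ : ℝ → Euc n} {T : ℝ}
    (hx₀ : ContinuousOn x₀ (Icc 0 T)) (hx₀U : ∀ t ∈ Icc 0 T, x₀ t ∈ U) :
    ∃ r > 0, ∀ τ ≤ T, ENNReal.ofReal r ≤ trajDist U x₀ τ := by
  obtain ⟨r, hr, hrU⟩ := (isCompact_Icc.image_of_continuousOn hx₀).exists_thickening_subset_open
    hU (image_subset_iff.2 hx₀U)
  refine ⟨r, hr, fun τ hτ => le_iInf₂ fun t ht => Metric.le_infEDist.2 fun y hy => ?_⟩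
  rw [edist_dist]
  refine ENNReal.ofReal_le_ofReal (le_of_not_gt fun hlt => hy (hrU ?_))
  exact Metric.mem_thickening_iff.2
    ⟨x₀ t, mem_image_of_mem _ ⟨ht.1, ht.2.trans hτ⟩, by rwa [dist_comm]⟩

/-- For small `τ`, the smallness conditions of Filippov's theorem are satisfied. -/
theorem exists_small_time {k ρ : ℝ → ℝ} {T r : ℝ} (hT : 0 < T) (hr : 0 < r)
    (hk : IntegrableOn k (Icc 0 T)) (hρ : IntegrableOn ρ (Icc 0 T)) :
    ∃ τ ∈ Ioc 0 T, ∫ t in 0..τ, k t < 1 ∧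
      ∫ t in 0..τ, ρ t < (1 - ∫ t in 0..τ, k t) * r := by
  have hlim : ∀ f : ℝ → ℝ, IntegrableOn f (Icc 0 T) →
      Filter.Tendsto (fun τ => ∫ t in 0..τ, f t) (nhdsWithin 0 (Ioc 0 T)) (nhds 0) := by
    intro f hf
    have h := (intervalIntegral.continuousOn_primitive_interval'
      ((intervalIntegrable_iff_integrableOn_Icc_of_le hT.le).2 hf) left_mem_uIcc) 0 left_mem_uIcc
    rw [ContinuousWithinAt, intervalIntegral.integral_same, uIcc_of_le hT.le] at h
    exact h.mono_left (nhdsWithin_mono _ Ioc_subset_Icc_self)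
  have hlim' := ((hlim k hk).const_sub 1).mul_const r
  rw [sub_zero, one_mul] at hlim'
  have hbot : (nhdsWithin (0 : ℝ) (Ioc 0 T)).NeBot := by
    rw [nhdsWithin_Ioc_eq_nhdsGT hT]
    infer_instance
  obtain ⟨τ, ⟨h1, h2⟩, h3⟩ := ((((hlim k hk).eventually_lt_const one_pos).and
    ((hlim ρ hρ).eventually_lt hlim' hr)).and self_mem_nhdsWithin).exists
  exact ⟨τ, h3, h1, h2⟩

end DiffIncl

/-! ### The main theorem. -/

theorem theorem8 {n : ℕ} (T : ℝ) (hT : 0 < T) (U : Set (DiffIncl.Euc n)) (hU : IsOpen U)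
    (F : ℝ → DiffIncl.Euc n → Set (DiffIncl.Euc n))
    -- `F` is defined on `[0, T] × U`
    (hF_nonempty : ∀ᵐ t ∂(volume.restrict (Icc 0 T)), ∀ x ∈ U, (F t x).Nonempty)
    -- the graph of `F(t, ·)` is closed
    (hF_closed : ∀ᵐ t ∂(volume.restrict (Icc 0 T)), DiffIncl.ClosedGraphOver U (F t))
    -- `F` is measurable in `t`
    (hF_meas : ∀ x y : DiffIncl.Euc n,
      AEMeasurable (fun t => Metric.infDist (x, y) (DiffIncl.graph (F t)))
        (volume.restrict (Icc 0 T)))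
    -- `F(t, ·)` is Hausdorff-Lipschitz on `U` with a summable rate `k(t)`
    (k : ℝ → ℝ) (hk : IntegrableOn k (Icc 0 T))
    (hF_lip : ∀ᵐ t ∂(volume.restrict (Icc 0 T)), ∀ x ∈ U, ∀ x' ∈ U,
      DiffIncl.HausdorffLE (F t x) (F t x') (k t * ‖x - x'‖))
    -- the reference trajectory `x₀(·)` on `[0, T]`, with `x₀(0) = a` and summable defect
    (a : DiffIncl.Euc n) (x₀ : ℝ → DiffIncl.Euc n) (hx₀ : AbsolutelyContinuousOnInterval x₀ 0 T)
    (hx₀U : ∀ t ∈ Icc 0 T, x₀ t ∈ U) (hx₀a : x₀ 0 = a)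
    (hρ : IntegrableOn (DiffIncl.defect F x₀) (Icc 0 T)) :
    -- there is a solution on some `[0, τ]`
    (∃ τ ∈ Ioc 0 T, ∃ x : ℝ → DiffIncl.Euc n,
      DiffIncl.IsSolution F a τ x ∧ ∀ t ∈ Icc 0 τ, x t ∈ U) ∧
    -- and the quantitative form for every sufficiently small `τ`
    (∀ τ ∈ Ioc 0 T, ∫ t in 0..τ, k t < 1 →
      ENNReal.ofReal (∫ t in 0..τ, DiffIncl.defect F x₀ t) <
        ENNReal.ofReal (1 - ∫ t in 0..τ, k t) * DiffIncl.trajDist U x₀ τ →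
      ∀ ε : ℝ, 0 < ε → ∃ x : ℝ → DiffIncl.Euc n,
        DiffIncl.IsSolution F a τ x ∧ (∀ t ∈ Icc 0 τ, x t ∈ U) ∧
        IntervalIntegrable (fun t => ‖deriv x t - deriv x₀ t‖) volume 0 τ ∧
        ∫ t in 0..τ, ‖deriv x t - deriv x₀ t‖ ≤
          (1 + ε) / (1 - ∫ t in 0..τ, k t) * ∫ t in 0..τ, DiffIncl.defect F x₀ t) := by
  suffices main : ∀ τ ∈ Ioc 0 T, ∫ t in 0..τ, k t < 1 →
      ENNReal.ofReal (∫ t in 0..τ, DiffIncl.defect F x₀ t) <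
        ENNReal.ofReal (1 - ∫ t in 0..τ, k t) * DiffIncl.trajDist U x₀ τ →
      ∀ ε : ℝ, 0 < ε → ∃ x : ℝ → DiffIncl.Euc n,
        DiffIncl.IsSolution F a τ x ∧ (∀ t ∈ Icc 0 τ, x t ∈ U) ∧
        IntervalIntegrable (fun t => ‖deriv x t - deriv x₀ t‖) volume 0 τ ∧
        ∫ t in 0..τ, ‖deriv x t - deriv x₀ t‖ ≤
          (1 + ε) / (1 - ∫ t in 0..τ, k t) * ∫ t in 0..τ, DiffIncl.defect F x₀ t by
    refine ⟨?_, main⟩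
    have hcont := hx₀.continuousOn
    rw [uIcc_of_le hT.le] at hcont
    obtain ⟨r, hr, hrle⟩ := DiffIncl.exists_pos_le_trajDist hU hcont hx₀U
    obtain ⟨τ, hτ, hk1, hξ⟩ := DiffIncl.exists_small_time hT hr hk hρ
    have hlt : ENNReal.ofReal (∫ t in 0..τ, DiffIncl.defect F x₀ t) <
        ENNReal.ofReal (1 - ∫ t in 0..τ, k t) * DiffIncl.trajDist U x₀ τ := by
      refine lt_of_lt_of_le ?_ (mul_le_mul_right (hrle τ hτ.2) _)
      rw [← ENNReal.ofReal_mul (by linarith)]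
      exact (ENNReal.ofReal_lt_ofReal_iff (mul_pos (by linarith) hr)).2 hξ
    obtain ⟨x, hx, hxU, -⟩ := main τ hτ hk1 hlt 1 one_pos
    exact ⟨τ, hτ, x, hx, hxU⟩
  intro τ hτ hK hξr ε hε
  have hsub : Icc 0 τ ⊆ Icc 0 T := Icc_subset_Icc_right hτ.2
  have hx₀τ : AbsolutelyContinuousOnInterval x₀ 0 τ :=
    hx₀.mono (by rwa [uIcc_of_le hτ.1.le, uIcc_of_le hT.le])
  have hρτ := hρ.mono_set hsub
  have hne := ae_restrict_of_ae_restrict_of_subset hsub hF_nonempty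
  have hcl := ae_restrict_of_ae_restrict_of_subset hsub hF_closed
  have hlip := ae_restrict_of_ae_restrict_of_subset hsub hF_lip
  have hmem : ∀ᵐ t ∂(volume.restrict (Icc 0 τ)), t ∈ Icc 0 τ := ae_restrict_mem measurableSet_Icc
  have hIcc : ∀ f : ℝ → ℝ, ∫ t in 0..τ, f t = ∫ t in Icc 0 τ, f t := fun f => by
    rw [intervalIntegral.integral_of_le hτ.1.le, integral_Icc_eq_integral_Ioc]
  have hρ0 : ∀ t, 0 ≤ DiffIncl.defect F x₀ t := fun t => Metric.infDist_nonneg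
  set K := ∫ t in 0..τ, k t
  set ξ := ∫ t in 0..τ, DiffIncl.defect F x₀ t with hξ
  have hK' : 0 < 1 - K := by linarith
  have hξ0 : 0 ≤ ξ := intervalIntegral.integral_nonneg hτ.1.le fun t _ => hρ0 t
  -- If `ξ = 0`, the bound leaves no room for errors, but `x₀` itself is a solution.
  rcases hξ0.eq_or_lt with h0 | hpos
  · have hzero : DiffIncl.defect F x₀ =ᵐ[volume.restrict (Icc 0 τ)] 0 :=
      (integral_eq_zero_iff_of_nonneg hρ0 hρτ).1 (by rw [← hIcc, ← hξ, h0])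
    refine ⟨x₀, ⟨hx₀τ, hx₀a, ?_⟩, fun t ht => hx₀U t (hsub ht), by simp, by
      simp only [sub_self, norm_zero, intervalIntegral.integral_zero]
      positivity⟩
    filter_upwards [hzero, hcl, hne, hmem] with t h1 h2 h3 h4
    exact DiffIncl.mem_of_infDist_eq_zero hU h2 (hx₀U t (hsub h4)) (h3 _ (hx₀U t (hsub h4))) h1
  -- In a one-point space every defect vanishes, contradicting `ξ > 0`.
  · have hnt : Nontrivial (DiffIncl.Euc n) := by
      by_contra hss
      rw [not_nontrivial_iff_subsingleton] at hss
      refine hpos.ne' ?_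
      rw [hξ, hIcc]
      refine integral_eq_zero_of_ae ?_
      filter_upwards [hne, hmem] with t h1 h2
      obtain ⟨y, hy⟩ := h1 _ (hx₀U t (hsub h2))
      exact Metric.infDist_zero_of_mem (by rwa [Subsingleton.elim (deriv x₀ t) y])
    have H : DiffIncl.IsFilippov U F k τ :=
      { isOpen := hU
        nonempty := hne
        closed := hcl
        measurable := fun x y => (hF_meas x y).mono_measure (Measure.restrict_mono hsub le_rfl)
        integrable := hk.mono_set hsub
        nonneg := by
          filter_upwards [hlip] with t ht
          exact DiffIncl.nonneg_of_hausdorffLE hU ⟨_, hx₀U 0 (left_mem_Icc.2 hT.le)⟩ ht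
        lipschitz := hlip }
    have hdiv : ENNReal.ofReal (ξ / (1 - K)) < DiffIncl.trajDist U x₀ τ := by
      rw [ENNReal.ofReal_div_of_pos hK']
      exact ENNReal.div_lt_of_lt_mul' hξr
    -- A real radius `s` is needed because `trajDist` may be `∞`.
    obtain ⟨s, -, hs1, hs2⟩ := ENNReal.lt_iff_exists_real_btwn.1 hdiv
    have hs : ξ < s * (1 - K) := (div_lt_iff₀ hK').1 (ENNReal.ofReal_lt_ofReal_iff'.1 hs1).1
    -- The first bound gives the factor `1 + ε`; the second leaves a gap between `R = (ξ + c) / (1 -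
    -- K)` and `s`, used as `δ`.
    let c := min (ε * ξ) ((s * (1 - K) - ξ) / 2)
    have hc : 0 < c := lt_min (mul_pos hε hpos) (by linarith)
    have hc1 : c ≤ ε * ξ := min_le_left _ _
    have hc2 : c ≤ (s * (1 - K) - ξ) / 2 := min_le_right _ _
    have hRs : (ξ + c) / (1 - K) < s := by
      rw [div_lt_iff₀ hK']
      linarith
    obtain ⟨x, hx, hxU, hxi, hxR⟩ := H.exists_isSolution hτ.1 (by rwa [← hIcc]) hx₀τ hρτ
      (R := (ξ + c) / (1 - K)) (δ := s - (ξ + c) / (1 - K)) (c := c) (by linarith) hc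
      (fun t ht => by
        rw [add_sub_cancel]
        exact DiffIncl.ball_subset_of_lt_trajDist hs2 ht)
      (by rw [← hIcc, ← hIcc])
    rw [hx₀a] at hx
    refine ⟨x, hx, hxU, hxi, hxR.trans ?_⟩
    rw [div_mul_eq_mul_div]
    exact div_le_div_of_nonneg_right (by linarith) hK'.le
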